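/- **Multipass automata.** Let $\Sigma$ be a finite alphabet, and write $\Sigma_\varepsilon=\Sigma\cup\{\varepsilon\}$, $\Gamma_\varepsilon=\Gamma\cup\{\varepsilon\}$. For $k\ge 1$, a *nondeterministic $k$-pass automaton* over $\Sigma$ has a finite set of states $Q$ with an initial state $q_0$, a finite stack alphabet $\Gamma$, and transition maps: $\delta(j,q,\sigma,\gamma)$, a finite subset of $Q\times\Gamma^*$, for $1\le j\le k$, $q\in Q$, $\sigma\in\Sigma_\varepsilon$, $\gamma\in\Gamma_\varepsilon$, with $\delta(j,q,\varepsilon,\varepsilon)=\emptyset$; $\delta(j,q,\sharp,\gamma)\subseteq Q$ for $j<k$; and $\delta(k,q,\sharp,\gamma)\in\{\text{accept},\text{not accept}\}$. It processes $w\sharp$ ($w\in\Sigma^*$, $\sharp$ an end-marker) in $k$ passes, starting in state $q_0$ with empty stack. On pass $j$, in state $q$ with $\gamma$ on top of the stack ($\gamma=\varepsilon$ if the stack is empty), it may choose $(q',\zeta)\in\delta(j,q,\sigma,\gamma)$, where $\sigma$ is the current letter (and then it advances on the tape) or $\sigma=\varepsilon$ (and then it does not), change to state $q'$ and replace $\gamma$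 by $\zeta$. At $\sharp$ on a pass $j<k$ it may choose $q'\in\delta(j,q,\sharp,\gamma)$ and begin pass $j+1$ in state $q'$ at the beginning of the input with the stack emptied; at $\sharp$ on pass $k$ it halts as $\delta(k,q,\sharp,\gamma)$ prescribes. A word is accepted if some computation on it ends in acceptance. The automaton is *deterministic* if each $\delta(j,q,\sigma,\gamma)$, $\sigma\in\Sigma_\varepsilon$, has at most one element; each $\delta(j,q,\sharp,\gamma)$ with $j<k$ has exactly one; for all $j,q,\gamma$ either $\delta(j,q,\varepsilon,\gamma)\neq\emptyset$ and $\delta(j,q,\sigma,\gamma)=\emptyset$ for all $\sigma\in\Sigma$, or $\delta(j,q,\varepsilon,\gamma)=\emptyset$ and $\delta(j,q,\sigma,\gamma)\ne\emptyset$ for all $\sigma\in\Sigma$; and it reads $\sharp$ only when no $\varepsilon$-transition is available. A language is *(non)deterministic multipass* if it is accepted by a (non)deterministic $k$-pass automaton for some $k\ge1$. **Classes of groups.** For a group $G$ with a finite generating family $X$, the word problem of $G$ relative to $X$ is the set of words over $X\cup X^{-1}$ (formal inverses) that represent $1$ in $G$. Let $\mathcal{BDG}$ (respectively $\mathcal{PG}$)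 be the class of finitely generated groups whose word problem relative to some finite generating family is a deterministic (respectively nondeterministic) multipass language. **Theorem.** Let $G$ be a group in $\mathcal{BDG}$ (respectively $\mathcal{PG}$), let $S\le G$ be a subgroup of finite index, and let $\varphi\colon G\to G$ be an automorphism of finite order with $\varphi(S)=S$. Let $g\mapsto\overline g$ be an isomorphism of $G$ onto a group $\overline G$. Then the (possibly twisted) double $$D=\langle\, G*\overline G\,;\ \varphi(s)=\overline s,\ s\in S\,\rangle,$$ that is, the quotient of the free product $G*\overline G$ by the normal closure of $\{\varphi(s)\,\overline s^{\,-1} : s\in S\}$, is again in $\mathcal{BDG}$ (respectively $\mathcal{PG}$). -/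

import Mathlib

universe u v

/-! ## Multipass automata

A `(k + 1)`-pass automaton reads the word `w` followed by an end-marker `k + 1` times; the passes are
indexed by `Fin (k + 1)`, so that every number of passes `≥ 1` occurs.  In the transition functions
`none : Option α` stands for an `ε`-transition (no letter is read), and `none : Option Γ` for
the empty stack.  Stacks and the words that replace their top letter are written with the top letter
first. -/

/-- The data describing a multipass automaton at a moment of its computation: the current pass, the
state, the part of the word (without the end-marker) still to be read on this pass, and the stack. -/
structure MultipassConfig (α : Type u) (k : ℕ) (Q Γ : Type) where
  pass : Fin (k + 1)
  state : Q
  rest : List α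
  stack : List Γ

/-- A deterministic `(k + 1)`-pass automaton with input alphabet `α`. -/
structure DetMultipassAutomaton (α : Type u) (k : ℕ) where
  /-- the set of states -/
  Q : Type
  /-- the stack alphabet -/
  Γ : Type
  finite_Q : Finite Q
  finite_Γ : Finite Γ
  /-- the initial state -/
  q₀ : Q
  /-- the (partial) transition function before the end-marker -/
  δ : Fin (k + 1) → Q → Option α → Option Γ → Option (Q × List Γ)
  /-- the transitions at the end-marker of a pass that is not the last one -/
  δNext : Fin k → Q → Option Γ → Q
  /-- the transitions at the end-marker of the last pass: `true` is the accepting halting state,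
  `false` the rejecting one -/
  δHalt : Q → Option Γ → Bool
  /-- no `ε`-transition when the stack is empty -/
  no_eps_empty : ∀ j q, δ j q none none = none
  /-- an `ε`-transition excludes the transitions that read a letter -/
  deterministic : ∀ j q γ, δ j q none γ ≠ none → ∀ a, δ j q (some a) γ = none
  /-- there is always an `ε`-transition or a transition reading the current letter -/
  progress : ∀ j q γ, δ j q none γ = none → ∀ a, δ j q (some a) γ ≠ none

namespace DetMultipassAutomaton

variable {α : Type u} {k : ℕ}

/-- One move of the automaton on the input word `input`.  An `ε`-transition, being independent of the
input symbol under the head, is made whenever it is available, also in front of the end-marker. -/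
inductive Step (M : DetMultipassAutomaton α k) (input : List α) :
    MultipassConfig α k M.Q M.Γ → MultipassConfig α k M.Q M.Γ → Prop
  | read (j : Fin (k + 1)) (q q' : M.Q) (a : α) (w : List α) (s ζ : List M.Γ)
      (h : M.δ j q (some a) s.head? = some (q', ζ)) :
      Step M input ⟨j, q, a :: w, s⟩ ⟨j, q', w, ζ ++ s.tail⟩
  | eps (j : Fin (k + 1)) (q q' : M.Q) (w : List α) (s ζ : List M.Γ)
      (h : M.δ j q none s.head? = some (q', ζ)) :
      Step M input ⟨j, q, w, s⟩ ⟨j, q', w, ζ ++ s.tail⟩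
  | next (j : Fin k) (q : M.Q) (s : List M.Γ)
      (h : M.δ j.castSucc q none s.head? = none) :
      Step M input ⟨j.castSucc, q, [], s⟩ ⟨j.succ, M.δNext j q s.head?, input, []⟩

/-- The automaton accepts `w` if its computation on `w`, started in the initial state with empty
stack, reaches the end-marker of the last pass and there halts in the accepting state. -/
def Accepts (M : DetMultipassAutomaton α k) (w : List α) : Prop :=
  ∃ (q : M.Q) (s : List M.Γ),
    Relation.ReflTransGen (M.Step w) ⟨0, M.q₀, w, []⟩ ⟨Fin.last k, q, [], s⟩ ∧
    M.δ (Fin.last k) q none s.head? = none ∧ M.δHalt q s.head? = true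

/-- The language accepted by the automaton. -/
def language (M : DetMultipassAutomaton α k) : Language α :=
  {w | M.Accepts w}

end DetMultipassAutomaton

/-- A nondeterministic `(k + 1)`-pass automaton with input alphabet `α`. -/
structure NondetMultipassAutomaton (α : Type u) (k : ℕ) where
  /-- the set of states -/
  Q : Type
  /-- the stack alphabet -/
  Γ : Type
  finite_Q : Finite Q
  finite_Γ : Finite Γ
  /-- the initial state -/
  q₀ : Q
  /-- the possible transitions before the end-marker -/
  δ : Fin (k + 1) → Q → Option α → Option Γ → Set (Q × List Γ)
  /-- the possible transitions at the end-marker of a pass that is not the last one -/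
  δNext : Fin k → Q → Option Γ → Set Q
  /-- the transitions at the end-marker of the last pass: `true` is the accepting halting state,
  `false` the no-decision state -/
  δHalt : Q → Option Γ → Bool
  finite_δ : ∀ j q a γ, (δ j q a γ).Finite
  /-- no `ε`-transition when the stack is empty -/
  no_eps_empty : ∀ j q, δ j q none none = ∅

namespace NondetMultipassAutomaton

variable {α : Type u} {k : ℕ}

/-- One possible move of the automaton on the input word `input`. -/
inductive Step (M : NondetMultipassAutomaton α k) (input : List α) :
    MultipassConfig α k M.Q M.Γ → MultipassConfig α k M.Q M.Γ → Prop
  | read (j : Fin (k + 1)) (q q' : M.Q) (a : α) (w : List α) (s ζ : List M.Γ)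
      (h : (q', ζ) ∈ M.δ j q (some a) s.head?) :
      Step M input ⟨j, q, a :: w, s⟩ ⟨j, q', w, ζ ++ s.tail⟩
  | eps (j : Fin (k + 1)) (q q' : M.Q) (w : List α) (s ζ : List M.Γ)
      (h : (q', ζ) ∈ M.δ j q none s.head?) :
      Step M input ⟨j, q, w, s⟩ ⟨j, q', w, ζ ++ s.tail⟩
  | next (j : Fin k) (q q' : M.Q) (s : List M.Γ)
      (h : q' ∈ M.δNext j q s.head?) :
      Step M input ⟨j.castSucc, q, [], s⟩ ⟨j.succ, q', input, []⟩

/-- The automaton accepts `w` if some computation on `w`, started in the initial state with empty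
stack, reaches the end-marker of the last pass and there halts in the accepting state. -/
def Accepts (M : NondetMultipassAutomaton α k) (w : List α) : Prop :=
  ∃ (q : M.Q) (s : List M.Γ),
    Relation.ReflTransGen (M.Step w) ⟨0, M.q₀, w, []⟩ ⟨Fin.last k, q, [], s⟩ ∧
    M.δHalt q s.head? = true

/-- The language accepted by the automaton. -/
def language (M : NondetMultipassAutomaton α k) : Language α :=
  {w | M.Accepts w}

end NondetMultipassAutomaton

/-- Deterministic multipass languages. -/
def IsDetMultipass {α : Type u} (L : Language α) : Prop :=
  ∃ (k : ℕ) (M : DetMultipassAutomaton α k), M.language = L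

/-- Nondeterministic multipass languages. -/
def IsNondetMultipass {α : Type u} (L : Language α) : Prop :=
  ∃ (k : ℕ) (M : NondetMultipassAutomaton α k), M.language = L

/-! ## Word problems -/

/-- The word problem of `G` relative to the generators `x 0, …, x (n - 1)`.  The letter `(i, true)`
stands for `x i`, the letter `(i, false)` for its formal inverse. -/
def wordProblem {G : Type u} [Group G] {n : ℕ} (x : Fin n → G) : Language (Fin n × Bool) :=
  {w | (w.map fun l => if l.2 then x l.1 else (x l.1)⁻¹).prod = 1}

/-- `G` is finitely generated and has deterministic multipass word problem. -/
def InBDG (G : Type u) [Group G] : Prop :=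
  ∃ (n : ℕ) (x : Fin n → G),
    Subgroup.closure (Set.range x) = ⊤ ∧ IsDetMultipass (wordProblem x)

/-- `G` is finitely generated and has nondeterministic multipass word problem. -/
def InPG (G : Type u) [Group G] : Prop :=
  ∃ (n : ℕ) (x : Fin n → G),
    Subgroup.closure (Set.range x) = ⊤ ∧ IsNondetMultipass (wordProblem x)

/-! ## Twisted doubles -/

/-- The double of `G` over `S` twisted by `φ`: the quotient of the free product of `G` and its copy
`G'` by the relations `φ s = bar s` for `s ∈ S`. -/
abbrev TwistedDouble {G : Type u} {G' : Type v} [Group G] [Group G']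
    (S : Subgroup G) (φ : MulAut G) (bar : G ≃* G') : Type (max u v) :=
  Monoid.Coprod G G' ⧸ Subgroup.normalClosure
    {r : Monoid.Coprod G G' |
      ∃ s ∈ S, r = Monoid.Coprod.inl (φ s) * (Monoid.Coprod.inr (bar s))⁻¹}

/-! Composing the embedding of the second copy with `φ⁻¹` makes the two embeddings of $G$ agree on
$S$. The double then becomes the untwisted amalgam $G *_S G$, which retracts onto $G$ by folding the
two copies together. To multiply out a word in both copies, keep a stack of alternating factors
outside $S$ together with a pending element of $S$. By the normal form theorem a trivial word leaves
an empty stack. Conversely, an empty stack means that the word lies in one copy of $G$, where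
folding is injective. So a word is trivial iff its stack empties and its fold is trivial in $G$.

The second condition is the word problem of $G$ after relabelling letters. The first only asks which
products lie in $S$. Since $S$ has finite index, some homomorphism `θ` to a finite group has kernel
inside $S$, so the stack can be run on images under `θ`, by a real-time deterministic pushdown
automaton. One extra pass in front of the given automaton checks it.

The proof rests on `AmalgamStack.prod_eq_one_iff` for the group theory, and on
`detInter_accepts_iff` and `nondetInter_accepts_iff` for the extra pass. -/

/-! ## Intersections with real-time deterministic pushdown automata -/

/-- A real-time deterministic pushdown automaton: it reads one letter with every move and accepts
according to its final state and the final top of its stack. -/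
structure RealTimePDA (β : Type*) where
  /-- the set of states -/
  Q : Type
  /-- the stack alphabet -/
  Γ : Type
  finite_Q : Finite Q
  finite_Γ : Finite Γ
  /-- the initial state -/
  q₀ : Q
  /-- the transition function -/
  δ : Q → β → Option Γ → Q × List Γ
  /-- the acceptance condition -/
  acc : Q → Option Γ → Bool

namespace RealTimePDA

variable {α β : Type*} {k : ℕ}

/-- One move on a state and a stack. -/
def move (A : RealTimePDA β) (c : A.Q × List A.Γ) (b : β) : A.Q × List A.Γ :=
  ((A.δ c.1 b c.2.head?).1, (A.δ c.1 b c.2.head?).2 ++ c.2.tail)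

/-- The state and the stack after reading a word. -/
def run (A : RealTimePDA β) (w : List β) : A.Q × List A.Γ :=
  w.foldl A.move (A.q₀, [])

theorem run_append_singleton (A : RealTimePDA β) (w : List β) (b : β) :
    A.run (w ++ [b]) = A.move (A.run w) b := by
  simp [run]

/-- Whether a word is accepted. -/
def verdict (A : RealTimePDA β) (w : List β) : Bool :=
  A.acc (A.run w).1 (A.run w).2.head?

/-- The deterministic automaton that runs `A` on its first pass, keeps the verdict, and then runs `M`
on the word with the letters replaced according to `f`. -/
abbrev detInter (A : RealTimePDA β) (f : β → α) (M : DetMultipassAutomaton α k) :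
    DetMultipassAutomaton β (k + 1) where
  Q := A.Q × Bool × M.Q
  Γ := A.Γ ⊕ M.Γ
  finite_Q := by
    have := A.finite_Q
    have := M.finite_Q
    infer_instance
  finite_Γ := by
    have := A.finite_Γ
    have := M.finite_Γ
    infer_instance
  q₀ := (A.q₀, false, M.q₀)
  -- Pass `0` belongs to `A`, and pass `j + 1` is pass `j` of `M`. A letter of the other stack
  -- alphabet is read as an empty stack; no reachable configuration shows one, since stacks are
  -- emptied between passes.
  δ := Fin.cases
    (fun q a γ => a.map fun b =>
      let r := A.δ q.1 b (γ.bind Sum.getLeft?)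
      ((r.1, q.2), r.2.map Sum.inl))
    (fun j q a γ => (M.δ j q.2.2 (a.map f) (γ.bind Sum.getRight?)).map fun r =>
      ((q.1, q.2.1, r.1), r.2.map Sum.inr))
  δNext := Fin.cases
    (fun q γ => (q.1, A.acc q.1 (γ.bind Sum.getLeft?), M.q₀))
    (fun j q γ => (q.1, q.2.1, M.δNext j q.2.2 (γ.bind Sum.getRight?)))
  δHalt q γ := q.2.1 && M.δHalt q.2.2 (γ.bind Sum.getRight?)
  no_eps_empty j := by
    cases j using Fin.cases <;> simp [M.no_eps_empty]
  deterministic j q γ h a := by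
    cases j using Fin.cases with
    | zero => simp at h
    | succ j =>
      simp only [Fin.cases_succ, Option.map_none, ne_eq, Option.map_eq_none_iff] at h
      simp [M.deterministic _ _ _ h]
  progress j q γ h a := by
    cases j using Fin.cases with
    | zero => simp
    | succ j =>
      simp only [Fin.cases_succ, Option.map_none, Option.map_eq_none_iff] at h
      simpa using M.progress _ _ _ h (f a)

/-- The nondeterministic automaton that runs `A` on its first pass and, if `A` accepts, then runs `M`
on the word with the letters replaced according to `f`. -/
abbrev nondetInter (A : RealTimePDA β) (f : β → α) (M : NondetMultipassAutomaton α k) :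
    NondetMultipassAutomaton β (k + 1) where
  Q := A.Q × M.Q
  Γ := A.Γ ⊕ M.Γ
  finite_Q := by
    have := A.finite_Q
    have := M.finite_Q
    infer_instance
  finite_Γ := by
    have := A.finite_Γ
    have := M.finite_Γ
    infer_instance
  q₀ := (A.q₀, M.q₀)
  δ := Fin.cases
    (fun q a γ => {c | ∃ b, a = some b ∧ c =
      (((A.δ q.1 b (γ.bind Sum.getLeft?)).1, q.2),
        (A.δ q.1 b (γ.bind Sum.getLeft?)).2.map Sum.inl)})
    (fun j q a γ => (fun r : M.Q × List M.Γ => ((q.1, r.1), r.2.map Sum.inr)) ''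
      M.δ j q.2 (a.map f) (γ.bind Sum.getRight?))
  -- An empty set of successors blocks the computation when `A` rejects, so no verdict has to be
  -- stored.
  δNext := Fin.cases
    (fun q γ => {c | A.acc q.1 (γ.bind Sum.getLeft?) = true ∧ c = (q.1, M.q₀)})
    (fun j q γ => Prod.mk q.1 '' M.δNext j q.2 (γ.bind Sum.getRight?))
  δHalt q γ := M.δHalt q.2 (γ.bind Sum.getRight?)
  finite_δ j q a γ := by
    cases j using Fin.cases with
    | zero =>
      cases a with
      | none => simp
      | some b => simp
    | succ j => exact (M.finite_δ _ _ _ _).image _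
  no_eps_empty j q := by
    cases j using Fin.cases <;> simp [M.no_eps_empty]

@[simp]
theorem bind_getLeft?_map_inl {γ γ' : Type*} (o : Option γ) :
    (o.map (Sum.inl : γ → γ ⊕ γ')).bind Sum.getLeft? = o := by
  cases o <;> rfl

@[simp]
theorem bind_getRight?_map_inr {γ γ' : Type*} (o : Option γ') :
    (o.map (Sum.inr : γ' → γ ⊕ γ')).bind Sum.getRight? = o := by
  cases o <;> rfl

/-! ### Simulation in the deterministic case. -/

section Det

variable (A : RealTimePDA β) (f : β → α) (M : DetMultipassAutomaton α k)

theorem detInter_first_pass (w u v : List β) (huv : w = u ++ v) :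
    Relation.ReflTransGen ((A.detInter f M).Step w) ⟨0, (A.q₀, false, M.q₀), w, []⟩
      ⟨0, ((A.run u).1, false, M.q₀), v, (A.run u).2.map Sum.inl⟩ := by
  induction u using List.reverseRecOn generalizing v with
  | nil => subst huv; exact .refl
  | append_singleton u b ih =>
    refine (ih (b :: v) (by simpa using huv)).tail ?_
    rw [run_append_singleton]
    have := DetMultipassAutomaton.Step.read (M := A.detInter f M) (input := w) 0
      ((A.run u).1, false, M.q₀) ((A.move (A.run u) b).1, false, M.q₀) b v
      ((A.run u).2.map Sum.inl) ((A.δ (A.run u).1 b (A.run u).2.head?).2.map Sum.inl)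
      (by simp [detInter, move])
    simpa [move] using this

/-- The unread word `r` is carried along because `f` need not be injective: the tape of `M` does not
determine it. -/
theorem detInter_step_of_step (w : List β) (q : A.Q) (t : Bool)
    {c d : MultipassConfig α k M.Q M.Γ} (h : M.Step (w.map f) c d) (r : List β)
    (hr : c.rest = r.map f) :
    ∃ r', d.rest = r'.map f ∧ (A.detInter f M).Step w
      ⟨c.pass.succ, (q, t, c.state), r, c.stack.map Sum.inr⟩
      ⟨d.pass.succ, (q, t, d.state), r', d.stack.map Sum.inr⟩ := by
  cases h with
  | read j p p' a v s ζ h =>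
    obtain ⟨b, r', rfl, rfl, rfl⟩ := List.map_eq_cons_iff.1 hr.symm
    refine ⟨r', rfl, ?_⟩
    have := DetMultipassAutomaton.Step.read (M := A.detInter f M) (input := w) j.succ
      (q, t, p) (q, t, p') b r' (s.map Sum.inr) (ζ.map Sum.inr)
      (by simp [detInter, h])
    simpa using this
  | eps j p p' v s ζ h =>
    refine ⟨r, hr, ?_⟩
    have := DetMultipassAutomaton.Step.eps (M := A.detInter f M) (input := w) j.succ
      (q, t, p) (q, t, p') r (s.map Sum.inr) (ζ.map Sum.inr)
      (by simp [detInter, h])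
    simpa using this
  | next j p s h =>
    obtain rfl : r = [] := List.map_eq_nil_iff.1 hr.symm
    refine ⟨w, rfl, ?_⟩
    have := DetMultipassAutomaton.Step.next (M := A.detInter f M) (input := w) j.succ
      (q, t, p) (s.map Sum.inr)
      (by simp [detInter, h])
    simpa [detInter, ← Fin.succ_castSucc] using this

theorem detInter_later_passes (w : List β) (q : A.Q) (t : Bool)
    {d : MultipassConfig α k M.Q M.Γ}
    (h : Relation.ReflTransGen (M.Step (w.map f)) ⟨0, M.q₀, w.map f, []⟩ d) :
    ∃ r, d.rest = r.map f ∧ Relation.ReflTransGen ((A.detInter f M).Step w)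
      ⟨1, (q, t, M.q₀), w, []⟩ ⟨d.pass.succ, (q, t, d.state), r, d.stack.map Sum.inr⟩ := by
  induction h with
  | refl => exact ⟨w, rfl, .refl⟩
  | tail _ hstep ih =>
    obtain ⟨r, hr, hrun⟩ := ih
    obtain ⟨r', hr', hstep'⟩ := A.detInter_step_of_step f M w q t hstep r hr
    exact ⟨r', hr', hrun.tail hstep'⟩

/-- The invariant that excludes stray computations; it yields the forward direction of
`detInter_accepts_iff`. The last state `q` of `A` plays no role once the verdict is stored. -/
theorem detInter_reachable (w : List β)
    {c : MultipassConfig β (k + 1) (A.detInter f M).Q (A.detInter f M).Γ}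
    (h : Relation.ReflTransGen ((A.detInter f M).Step w) ⟨0, (A.q₀, false, M.q₀), w, []⟩ c) :
    (∃ u v, w = u ++ v ∧
      c = ⟨0, ((A.run u).1, false, M.q₀), v, (A.run u).2.map Sum.inl⟩) ∨
    ∃ (q : A.Q) (d : MultipassConfig α k M.Q M.Γ) (r : List β), d.rest = r.map f ∧
      c = ⟨d.pass.succ, (q, A.verdict w, d.state), r, d.stack.map Sum.inr⟩ ∧
      Relation.ReflTransGen (M.Step (w.map f)) ⟨0, M.q₀, w.map f, []⟩ d := by
  induction h with
  | refl => exact .inl ⟨[], w, rfl, rfl⟩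
  | tail _ hstep ih =>
    rcases ih with ⟨u, v, huv, rfl⟩ | ⟨q, ⟨j, p, rest, s⟩, r, hr, rfl, hrun⟩
    · generalize hc : MultipassConfig.mk _ _ _ _ = c at hstep
      cases hstep with
      | read j p p' a v s ζ h =>
        simp only [MultipassConfig.mk.injEq] at hc
        obtain ⟨rfl, rfl, rfl, rfl⟩ := hc
        simp only [detInter, Fin.cases_zero, List.head?_map, bind_getLeft?_map_inl, Option.map_some,
          Option.some.injEq, Prod.mk.injEq] at h
        obtain ⟨rfl, rfl⟩ := h
        exact .inl ⟨u ++ [a], v, by simp [huv], by simp [run_append_singleton, move]⟩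
      | eps j p p' v s ζ h =>
        simp only [MultipassConfig.mk.injEq] at hc
        obtain ⟨rfl, rfl, rfl, rfl⟩ := hc
        simp [detInter] at h
      | next j p s h =>
        simp only [MultipassConfig.mk.injEq] at hc
        obtain ⟨hj, rfl, rfl, rfl⟩ := hc
        obtain rfl : j = 0 := Fin.castSucc_injective _ hj.symm
        obtain rfl : w = u := by simpa using huv
        refine .inr ⟨(A.run w).1, ⟨0, M.q₀, w.map f, []⟩, w, rfl, ?_, .refl⟩
        simp [detInter, verdict]
    · generalize hc : MultipassConfig.mk _ _ _ _ = c at hstep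
      obtain rfl : rest = r.map f := hr
      cases hstep with
      | read j' p' p'' a v s' ζ h =>
        simp only [MultipassConfig.mk.injEq] at hc
        obtain ⟨rfl, rfl, rfl, rfl⟩ := hc
        simp only [detInter, Fin.cases_succ, List.head?_map, bind_getRight?_map_inr, Option.map_some,
          Option.map_eq_some_iff, Prod.mk.injEq] at h
        obtain ⟨⟨p', ζ'⟩, h, rfl, rfl⟩ := h
        exact .inr ⟨q, ⟨j, p', v.map f, ζ' ++ s.tail⟩, v, rfl, by simp,
          hrun.tail (.read _ _ _ _ _ _ _ h)⟩
      | eps j' p' p'' v s' ζ h =>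
        simp only [MultipassConfig.mk.injEq] at hc
        obtain ⟨rfl, rfl, rfl, rfl⟩ := hc
        simp only [detInter, Fin.cases_succ, List.head?_map, bind_getRight?_map_inr, Option.map_none,
          Option.map_eq_some_iff, Prod.mk.injEq] at h
        obtain ⟨⟨p', ζ'⟩, h, rfl, rfl⟩ := h
        exact .inr ⟨q, ⟨j, p', r.map f, ζ' ++ s.tail⟩, r, rfl, by simp,
          hrun.tail (.eps _ _ _ _ _ _ h)⟩
      | next j' p' s' h =>
        simp only [MultipassConfig.mk.injEq] at hc
        obtain ⟨hj, rfl, rfl, rfl⟩ := hc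
        cases j' using Fin.cases with
        | zero => simp at hj
        | succ i =>
          -- Shifting pass numbers by one commutes with `Fin.castSucc`, so the end of pass `i + 1`
          -- is the end of pass `i` of `M`.
          rw [← Fin.succ_castSucc] at hj h
          obtain rfl := Fin.succ_injective _ hj
          simp only [detInter, Fin.cases_succ, List.head?_map, bind_getRight?_map_inr, Option.map_none,
            Option.map_eq_none_iff] at h
          refine .inr ⟨q, ⟨i.succ, M.δNext i p s.head?, w.map f, []⟩, w, rfl, ?_,
            hrun.tail (.next _ _ _ h)⟩
          simp [detInter]

theorem detInter_accepts_iff (w : List β) :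
    (A.detInter f M).Accepts w ↔ A.verdict w = true ∧ M.Accepts (w.map f) := by
  constructor
  · rintro ⟨q, s, hrun, heps, hhalt⟩
    rcases A.detInter_reachable f M w hrun with ⟨u, v, -, hc⟩ | ⟨q', ⟨j, p, rest, t⟩, r, hr, hc, hM⟩
    · simp [Fin.ext_iff] at hc
    · simp only [MultipassConfig.mk.injEq] at hc
      obtain ⟨hj, rfl, rfl, rfl⟩ := hc
      rw [← Fin.succ_last] at hj heps
      obtain rfl := Fin.succ_injective _ hj
      simp only [detInter, Fin.cases_succ, List.head?_map, bind_getRight?_map_inr, Option.map_none,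
        Option.map_eq_none_iff, Bool.and_eq_true] at heps hhalt
      obtain rfl : rest = [] := hr
      exact ⟨hhalt.1, p, t, hM, heps, hhalt.2⟩
  · rintro ⟨hA, q, s, hrun, heps, hhalt⟩
    obtain ⟨r, hr, hrun'⟩ := A.detInter_later_passes f M w (A.run w).1 (A.verdict w) hrun
    obtain rfl : r = [] := List.map_eq_nil_iff.1 hr.symm
    refine ⟨((A.run w).1, A.verdict w, q), s.map Sum.inr,
      ((A.detInter_first_pass f M w w [] (by simp)).tail ?_).trans hrun', ?_, ?_⟩
    · have := DetMultipassAutomaton.Step.next (M := A.detInter f M) (input := w) 0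
        ((A.run w).1, false, M.q₀) ((A.run w).2.map Sum.inl) (by simp [detInter])
      simpa [detInter, verdict] using this
    · rw [← Fin.succ_last]
      simp only [Fin.cases_succ, List.head?_map, bind_getRight?_map_inr, Option.map_none, heps]
    · simp [detInter, hhalt, hA]

end Det

/-! ### Simulation in the nondeterministic case. -/

section Nondet

variable (A : RealTimePDA β) (f : β → α) (M : NondetMultipassAutomaton α k)

theorem nondetInter_first_pass (w u v : List β) (huv : w = u ++ v) :
    Relation.ReflTransGen ((A.nondetInter f M).Step w) ⟨0, (A.q₀, M.q₀), w, []⟩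
      ⟨0, ((A.run u).1, M.q₀), v, (A.run u).2.map Sum.inl⟩ := by
  induction u using List.reverseRecOn generalizing v with
  | nil => subst huv; exact .refl
  | append_singleton u b ih =>
    refine (ih (b :: v) (by simpa using huv)).tail ?_
    rw [run_append_singleton]
    have := NondetMultipassAutomaton.Step.read (M := A.nondetInter f M) (input := w) 0
      ((A.run u).1, M.q₀) ((A.move (A.run u) b).1, M.q₀) b v
      ((A.run u).2.map Sum.inl) ((A.δ (A.run u).1 b (A.run u).2.head?).2.map Sum.inl)
      (by simp [nondetInter, move])
    simpa [move] using this

theorem nondetInter_step_of_step (w : List β) (q : A.Q)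
    {c d : MultipassConfig α k M.Q M.Γ} (h : M.Step (w.map f) c d) (r : List β)
    (hr : c.rest = r.map f) :
    ∃ r', d.rest = r'.map f ∧ (A.nondetInter f M).Step w
      ⟨c.pass.succ, (q, c.state), r, c.stack.map Sum.inr⟩
      ⟨d.pass.succ, (q, d.state), r', d.stack.map Sum.inr⟩ := by
  cases h with
  | read j p p' a v s ζ h =>
    obtain ⟨b, r', rfl, rfl, rfl⟩ := List.map_eq_cons_iff.1 hr.symm
    refine ⟨r', rfl, ?_⟩
    have := NondetMultipassAutomaton.Step.read (M := A.nondetInter f M) (input := w) j.succ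
      (q, p) (q, p') b r' (s.map Sum.inr) (ζ.map Sum.inr)
      ⟨(p', ζ), by simpa using h, rfl⟩
    simpa using this
  | eps j p p' v s ζ h =>
    refine ⟨r, hr, ?_⟩
    have := NondetMultipassAutomaton.Step.eps (M := A.nondetInter f M) (input := w) j.succ
      (q, p) (q, p') r (s.map Sum.inr) (ζ.map Sum.inr)
      ⟨(p', ζ), by simpa using h, rfl⟩
    simpa using this
  | next j p p' s h =>
    obtain rfl : r = [] := List.map_eq_nil_iff.1 hr.symm
    exact ⟨w, rfl, .next (M := A.nondetInter f M) j.succ (q, p) (q, p') (s.map Sum.inr)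
      ⟨p', by simpa using h, rfl⟩⟩

theorem nondetInter_later_passes (w : List β) (q : A.Q)
    {d : MultipassConfig α k M.Q M.Γ}
    (h : Relation.ReflTransGen (M.Step (w.map f)) ⟨0, M.q₀, w.map f, []⟩ d) :
    ∃ r, d.rest = r.map f ∧ Relation.ReflTransGen ((A.nondetInter f M).Step w)
      ⟨1, (q, M.q₀), w, []⟩ ⟨d.pass.succ, (q, d.state), r, d.stack.map Sum.inr⟩ := by
  induction h with
  | refl => exact ⟨w, rfl, .refl⟩
  | tail _ hstep ih =>
    obtain ⟨r, hr, hrun⟩ := ih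
    obtain ⟨r', hr', hstep'⟩ := A.nondetInter_step_of_step f M w q hstep r hr
    exact ⟨r', hr', hrun.tail hstep'⟩

/-- Leaving pass `0` requires a positive verdict, which replaces the stored bit of the deterministic
invariant. -/
theorem nondetInter_reachable (w : List β)
    {c : MultipassConfig β (k + 1) (A.nondetInter f M).Q (A.nondetInter f M).Γ}
    (h : Relation.ReflTransGen ((A.nondetInter f M).Step w) ⟨0, (A.q₀, M.q₀), w, []⟩ c) :
    (∃ u v, w = u ++ v ∧
      c = ⟨0, ((A.run u).1, M.q₀), v, (A.run u).2.map Sum.inl⟩) ∨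
    A.verdict w = true ∧
      ∃ (q : A.Q) (d : MultipassConfig α k M.Q M.Γ) (r : List β), d.rest = r.map f ∧
        c = ⟨d.pass.succ, (q, d.state), r, d.stack.map Sum.inr⟩ ∧
        Relation.ReflTransGen (M.Step (w.map f)) ⟨0, M.q₀, w.map f, []⟩ d := by
  induction h with
  | refl => exact .inl ⟨[], w, rfl, rfl⟩
  | tail _ hstep ih =>
    rcases ih with ⟨u, v, huv, rfl⟩ | ⟨hA, q, ⟨j, p, rest, s⟩, r, hr, rfl, hrun⟩
    · generalize hc : MultipassConfig.mk _ _ _ _ = c at hstep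
      cases hstep with
      | read j p p' a v s ζ h =>
        simp only [MultipassConfig.mk.injEq] at hc
        obtain ⟨rfl, rfl, rfl, rfl⟩ := hc
        obtain ⟨b, hb, h⟩ := h
        obtain rfl : a = b := by simpa using hb
        simp only [List.head?_map, bind_getLeft?_map_inl, Prod.mk.injEq] at h
        obtain ⟨rfl, rfl⟩ := h
        exact .inl ⟨u ++ [a], v, by simp [huv], by simp [run_append_singleton, move]⟩
      | eps j p p' v s ζ h =>
        simp only [MultipassConfig.mk.injEq] at hc
        obtain ⟨rfl, rfl, rfl, rfl⟩ := hc
        obtain ⟨b, hb, h⟩ := h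
        simp at hb
      | next j p p' s h =>
        simp only [MultipassConfig.mk.injEq] at hc
        obtain ⟨hj, rfl, rfl, rfl⟩ := hc
        obtain rfl : j = 0 := Fin.castSucc_injective _ hj.symm
        obtain rfl : w = u := by simpa using huv
        obtain ⟨hA, rfl⟩ := h
        rw [List.head?_map, bind_getLeft?_map_inl] at hA
        exact .inr ⟨hA, (A.run w).1, ⟨0, M.q₀, w.map f, []⟩, w, rfl, rfl, .refl⟩
    · generalize hc : MultipassConfig.mk _ _ _ _ = c at hstep
      obtain rfl : rest = r.map f := hr
      refine .inr ⟨hA, q, ?_⟩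
      cases hstep with
      | read j' p' p'' a v s' ζ h =>
        simp only [MultipassConfig.mk.injEq] at hc
        obtain ⟨rfl, rfl, rfl, rfl⟩ := hc
        obtain ⟨⟨p', ζ'⟩, h, h'⟩ := h
        obtain ⟨rfl, rfl⟩ := Prod.mk.inj h'
        rw [List.head?_map, bind_getRight?_map_inr] at h
        exact ⟨⟨j, p', v.map f, ζ' ++ s.tail⟩, v, rfl, by simp,
          hrun.tail (.read _ _ _ _ _ _ _ h)⟩
      | eps j' p' p'' v s' ζ h =>
        simp only [MultipassConfig.mk.injEq] at hc
        obtain ⟨rfl, rfl, rfl, rfl⟩ := hc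
        obtain ⟨⟨p', ζ'⟩, h, h'⟩ := h
        obtain ⟨rfl, rfl⟩ := Prod.mk.inj h'
        rw [List.head?_map, bind_getRight?_map_inr] at h
        exact ⟨⟨j, p', r.map f, ζ' ++ s.tail⟩, r, rfl, by simp,
          hrun.tail (.eps _ _ _ _ _ _ h)⟩
      | next j' p' p'' s' h =>
        simp only [MultipassConfig.mk.injEq] at hc
        obtain ⟨hj, rfl, rfl, rfl⟩ := hc
        cases j' using Fin.cases with
        | zero => simp at hj
        | succ i =>
          rw [← Fin.succ_castSucc] at hj
          obtain rfl := Fin.succ_injective _ hj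
          obtain ⟨p', h, rfl⟩ := h
          rw [List.head?_map, bind_getRight?_map_inr] at h
          exact ⟨⟨i.succ, p', w.map f, []⟩, w, rfl, rfl, hrun.tail (.next _ _ _ _ h)⟩

theorem nondetInter_accepts_iff (w : List β) :
    (A.nondetInter f M).Accepts w ↔ A.verdict w = true ∧ M.Accepts (w.map f) := by
  constructor
  · rintro ⟨q, s, hrun, hhalt⟩
    rcases A.nondetInter_reachable f M w hrun with
      ⟨u, v, -, hc⟩ | ⟨hA, q', ⟨j, p, rest, t⟩, r, hr, hc, hM⟩
    · simp [Fin.ext_iff] at hc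
    · simp only [MultipassConfig.mk.injEq] at hc
      obtain ⟨hj, rfl, rfl, rfl⟩ := hc
      rw [← Fin.succ_last] at hj
      obtain rfl := Fin.succ_injective _ hj
      obtain rfl : rest = [] := hr
      exact ⟨hA, p, t, hM, by simpa [nondetInter] using hhalt⟩
  · rintro ⟨hA, q, s, hrun, hhalt⟩
    obtain ⟨r, hr, hrun'⟩ := A.nondetInter_later_passes f M w (A.run w).1 hrun
    obtain rfl : r = [] := List.map_eq_nil_iff.1 hr.symm
    refine ⟨((A.run w).1, q), s.map Sum.inr,
      ((A.nondetInter_first_pass f M w w [] (by simp)).tail ?_).trans hrun', ?_⟩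
    · exact .next (M := A.nondetInter f M) 0 ((A.run w).1, M.q₀) ((A.run w).1, M.q₀)
        ((A.run w).2.map Sum.inl) ⟨by rwa [List.head?_map, bind_getLeft?_map_inl], rfl⟩
    · simp [nondetInter, hhalt]

end Nondet

end RealTimePDA

/-! ### Closure of multipass languages under relabelling and the extra pass. -/

theorem IsDetMultipass.inter_realTimePDA {α β : Type*} {L : Language α} (hL : IsDetMultipass L)
    (f : β → α) (A : RealTimePDA β) :
    IsDetMultipass {w : List β | A.verdict w = true ∧ w.map f ∈ L} := by
  obtain ⟨k, M, rfl⟩ := hL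
  exact ⟨k + 1, A.detInter f M, Set.ext fun w => A.detInter_accepts_iff f M w⟩

theorem IsNondetMultipass.inter_realTimePDA {α β : Type*} {L : Language α}
    (hL : IsNondetMultipass L) (f : β → α) (A : RealTimePDA β) :
    IsNondetMultipass {w : List β | A.verdict w = true ∧ w.map f ∈ L} := by
  obtain ⟨k, M, rfl⟩ := hL
  exact ⟨k + 1, A.nondetInter f M, Set.ext fun w => A.nondetInter_accepts_iff f M w⟩

/-! ## Reduced words in an amalgam of two copies of a group -/

namespace AmalgamStack

open Classical in
/-- How the pending element `h` and the top of the stack change when the element `a.2` of the factor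
`a.1` is multiplied from the right. -/
noncomputable def push {P : Type*} [Group P] (H : Subgroup P) (h : P) (a : Bool × P) :
    Option (Bool × P) → P × List (Bool × P)
  -- In use `h ∈ H`, so `h` belongs to both factors and is absorbed into that of `a`. A product
  -- falling into `H` is not stacked but becomes the new pending element.
  | none => if h * a.2 ∈ H then (h * a.2, []) else (1, [(a.1, h * a.2)])
  | some t =>
    if t.1 = a.1 then
      if t.2 * (h * a.2) ∈ H then (t.2 * (h * a.2), []) else (1, [(t.1, t.2 * (h * a.2))])
    else if h * a.2 ∈ H then (h * a.2, [t]) else (1, [(a.1, h * a.2), t])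

/-- Multiplication by an element of a factor, on pending elements and stacks. -/
noncomputable def move {P : Type*} [Group P] (H : Subgroup P) (c : P × List (Bool × P))
    (a : Bool × P) : P × List (Bool × P) :=
  ((push H c.1 a c.2.head?).1, (push H c.1 a c.2.head?).2 ++ c.2.tail)

variable {G P D : Type*} [Group G] [Group P] [Group D]

/-- The effect of a homomorphism on pending elements and stacks. -/
def map (θ : G →* P) (c : G × List (Bool × G)) : P × List (Bool × P) :=
  (θ c.1, c.2.map (Prod.map id θ))

/-- The branches of `push` depend only on labels and on membership in the subgroup, and membership
in `H.comap θ` is visible after `θ`. Hence the stack over `P` simulates the one over `G`. -/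
theorem map_move (θ : G →* P) (H : Subgroup P) (c : G × List (Bool × G)) (a : Bool × G) :
    map θ (move (H.comap θ) c a) = move H (map θ c) (Prod.map id θ a) := by
  obtain ⟨h, s⟩ := c
  rcases s with _ | ⟨t, s⟩
  · simp only [move, map, push, List.head?_nil, List.map_nil, Subgroup.mem_comap, map_mul,
      Prod.map_snd, Prod.map_fst, id]
    split_ifs <;> simp_all
  · simp only [move, map, push, List.head?_cons, List.map_cons, Subgroup.mem_comap, map_mul,
      Prod.map_snd, Prod.map_fst, id]
    split_ifs <;> simp_all [Prod.map]

theorem map_foldl_move (θ : G →* P) (H : Subgroup P) (w : List (Bool × G))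
    (c : G × List (Bool × G)) :
    map θ (w.foldl (move (H.comap θ)) c) = (w.map (Prod.map id θ)).foldl (move H) (map θ c) := by
  induction w generalizing c with
  | nil => rfl
  | cons a w ih => simp [ih, map_move]

/-- The product of the entries of a stack, from bottom to top. -/
def stackProd (j : Bool → G →* D) : List (Bool × G) → D
  | [] => 1
  | t :: s => stackProd j s * j t.1 t.2

/-- The element represented by a pending element and a stack. -/
def value (j : Bool → G →* D) (c : G × List (Bool × G)) : D :=
  stackProd j c.2 * j true c.1

/-- A pending element in the amalgamated subgroup together with a reduced stack. -/
structure Reduced (S : Subgroup G) (c : G × List (Bool × G)) : Prop where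
  pending : c.1 ∈ S
  notMem : ∀ t ∈ c.2, t.2 ∉ S
  alternating : c.2.IsChain fun a b => a.1 ≠ b.1

theorem reduced_nil (S : Subgroup G) : Reduced S ((1 : G), []) :=
  ⟨S.one_mem, by simp, .nil⟩

/-- A modified top keeps its label, popping leaves an alternating stack, and a new entry is pushed
only on a top from the other factor. -/
theorem Reduced.move {S : Subgroup G} {c : G × List (Bool × G)} (hc : Reduced S c)
    (a : Bool × G) : Reduced S (move S c a) := by
  obtain ⟨h, s⟩ := c
  obtain ⟨h₁, h₂, h₃⟩ := hc
  rcases s with _ | ⟨t, s⟩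
  · simp only [AmalgamStack.move, push, List.head?_nil]
    split_ifs with h₄
    · exact ⟨h₄, by simp, by simp⟩
    · exact ⟨S.one_mem, by simpa using h₄, by simp⟩
  · simp only [List.mem_cons, forall_eq_or_imp] at h₂
    simp only [List.isChain_cons] at h₃
    simp only [AmalgamStack.move, push, List.head?_cons]
    split_ifs with h₄ h₅ h₅
    · exact ⟨h₅, by simpa using h₂.2, by simpa using h₃.2⟩
    · exact ⟨S.one_mem, by simpa using ⟨h₅, by simpa using h₂.2⟩,
        by simpa [List.isChain_cons] using h₃⟩
    · exact ⟨h₅, by simpa using h₂, by simpa [List.isChain_cons] using h₃⟩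
    · exact ⟨S.one_mem, by simpa using ⟨h₅, by simpa using h₂⟩,
        List.isChain_cons_cons.2 ⟨fun h => h₄ h.symm, List.isChain_cons.2 h₃⟩⟩

theorem Reduced.foldl_move {S : Subgroup G} (w : List (Bool × G)) {c : G × List (Bool × G)}
    (hc : Reduced S c) : Reduced S (w.foldl (AmalgamStack.move S) c) := by
  induction w generalizing c with
  | nil => exact hc
  | cons a w ih => exact ih (hc.move a)

/-- Elements of `S` have the same image under both `j i`, so a pending element may be moved into
whichever factor the next letter needs. -/
theorem value_move {S : Subgroup G} {j : Bool → G →* D} (hj : ∀ s ∈ S, j false s = j true s)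
    {c : G × List (Bool × G)} (hc : Reduced S c) (a : Bool × G) :
    value j (move S c a) = value j c * j a.1 a.2 := by
  have hj' : ∀ i, ∀ s ∈ S, j true s = j i s := fun i s hs => by
    cases i
    · exact (hj s hs).symm
    · rfl
  obtain ⟨h, s⟩ := c
  have h₁ := hc.pending
  rcases s with _ | ⟨t, s⟩
  · simp only [move, push, List.head?_nil]
    split_ifs with h₄
    · simp [value, stackProd, hj' a.1 _ h₄, hj' a.1 _ h₁]
    · simp [value, stackProd, hj' a.1 _ h₁]
  · simp only [move, push, List.head?_cons]
    split_ifs with h₄ h₅ h₅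
    · simp [value, stackProd, hj' a.1 _ h₁, hj' a.1 _ h₅, h₄, mul_assoc]
    · simp [value, stackProd, hj' a.1 _ h₁, h₄, mul_assoc]
    · simp [value, stackProd, hj' a.1 _ h₁, hj' a.1 _ h₅, mul_assoc]
    · simp [value, stackProd, hj' a.1 _ h₁, mul_assoc]

theorem value_foldl_move {S : Subgroup G} {j : Bool → G →* D}
    (hj : ∀ s ∈ S, j false s = j true s) (w : List (Bool × G)) {c : G × List (Bool × G)}
    (hc : Reduced S c) :
    value j (w.foldl (move S) c) = value j c * (w.map fun a => j a.1 a.2).prod := by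
  induction w generalizing c with
  | nil => simp
  | cons a w ih => simp [ih (hc.move a), value_move hj hc, mul_assoc]

theorem stackProd_eq_prod (j : Bool → G →* D) (s : List (Bool × G)) :
    stackProd j s = (s.reverse.map fun a => j a.1 a.2).prod := by
  induction s with
  | nil => rfl
  | cons t s ih => simp [stackProd, ih]

theorem map_stackProd {E : Type*} [Group E] (j : Bool → G →* D) (κ : D →* E)
    (s : List (Bool × G)) :
    κ (stackProd j s) = stackProd (fun i => κ.comp (j i)) s := by
  induction s with
  | nil => simp [stackProd]
  | cons t s ih => simp [stackProd, ih]

/-- The normal form theorem for the amalgam of two copies of `G` over `S`. -/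
theorem Reduced.stack_eq_nil {S : Subgroup G} {c : G × List (Bool × G)} (hc : Reduced S c)
    (h : value (fun i => Monoid.PushoutI.of (φ := fun _ : Bool => S.subtype) i) c = 1) :
    c.2 = [] := by
  let w : Monoid.CoprodI.Word fun _ : Bool => G :=
    -- Stacks list their top first, while the product runs from bottom to top.
    { toList := c.2.reverse.map fun a => ⟨a.1, a.2⟩
      ne_one := by
        simp only [List.mem_map, List.mem_reverse, forall_exists_index, and_imp]
        rintro _ t ht rfl h
        exact hc.notMem t ht ((show t.2 = 1 from h) ▸ S.one_mem)
      chain_ne := by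
        rw [List.isChain_map, List.isChain_reverse]
        exact hc.alternating.imp fun a b hab => hab.symm }
  have hw : Monoid.PushoutI.Reduced (fun _ : Bool => S.subtype) w := by
    simp only [Monoid.PushoutI.Reduced, w, List.mem_map, List.mem_reverse, forall_exists_index,
      and_imp]
    rintro _ t ht rfl
    simpa using hc.notMem t ht
  have hprod : Monoid.PushoutI.ofCoprodI (φ := fun _ : Bool => S.subtype) w.prod =
      stackProd (fun i => Monoid.PushoutI.of (φ := fun _ : Bool => S.subtype) i) c.2 := by
    simp [stackProd_eq_prod, w, Monoid.CoprodI.Word.prod, map_list_prod, Function.comp_def]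
  -- If the value is `1`, the stack product is the inverse of the pending element, hence lies in the
  -- amalgamated subgroup; a reduced word with this property is empty.
  have := hw.eq_empty_of_mem_range (fun _ => S.subtype_injective) <| by
    rw [hprod, eq_inv_of_mul_eq_one_left h]
    exact inv_mem ⟨⟨c.1, hc.pending⟩,
      (Monoid.PushoutI.of_apply_eq_base (fun _ : Bool => S.subtype) true _).symm⟩
  simpa [w] using congrArg Monoid.CoprodI.Word.toList this

/-- The word problem in a group mapping to the amalgam of two copies of `G` over `S` and retracting to
`G`. -/
theorem prod_eq_one_iff {S : Subgroup G} {H : Subgroup P} (θ : G →* P) (hθ : H.comap θ = S)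
    (j : Bool → G →* D) (hj : ∀ s ∈ S, j false s = j true s)
    (κ : D →* Monoid.PushoutI fun _ : Bool => S.subtype)
    (hκ : ∀ i g, κ (j i g) = Monoid.PushoutI.of i g)
    (ρ : D →* G) (hρ : ∀ i g, ρ (j i g) = g) (w : List (Bool × G)) :
    (w.map fun a => j a.1 a.2).prod = 1 ↔
      (w.map (Prod.map id θ)).foldl (move H) (1, []) = (1, []) ∧ (w.map Prod.snd).prod = 1 := by
  subst hθ
  have hred := (reduced_nil (H.comap θ)).foldl_move w
  have hval := value_foldl_move hj w (reduced_nil _)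
  have hmap := map_foldl_move θ H w (1, [])
  have hρw : ρ (w.map fun a => j a.1 a.2).prod = (w.map Prod.snd).prod := by
    simp [map_list_prod, Function.comp_def, hρ]
  generalize w.foldl (move (H.comap θ)) (1, []) = c at hred hval hmap
  simp only [value, stackProd, map_one, mul_one, one_mul] at hval
  rw [show map θ (1, []) = (1, []) by simp [map]] at hmap
  rw [← hmap, ← hρw, ← hval]
  constructor
  · intro h
    -- The normal form theorem is applied to the image under `κ`; injectivity of `κ` is not needed.
    have hnil : c.2 = [] := hred.stack_eq_nil <| by
      have := congrArg κ h
      rw [map_mul, map_stackProd, map_one, hκ] at this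
      rw [← this, value]
      congr 2
      funext i
      ext g
      exact (hκ i g).symm
    refine ⟨?_, by rw [h, map_one]⟩
    have h1 : c.1 = 1 := by
      have := congrArg ρ h
      simpa [hnil, stackProd, hρ] using this
    simp [map, hnil, h1]
  -- From `h₁` only the empty stack is used: the word then equals `j true c.1`, and `ρ` turns `h₂`
  -- into `c.1 = 1`, which the image `θ c.1` alone could not show.
  · rintro ⟨h₁, h₂⟩
    have hnil : c.2 = [] := by simpa [map] using congrArg Prod.snd h₁
    simp only [hnil, stackProd, one_mul, hρ] at h₂
    simp [hnil, stackProd, h₂]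

end AmalgamStack

/-! ### The reduction over a finite group as a pushdown automaton. -/

namespace AmalgamStack

/-- The automaton multiplying out words over two copies of `P` amalgamated over `H`, where the letter
`b` stands for the element `(ℓ b).2` of the factor `(ℓ b).1`. -/
noncomputable def pda {β P : Type} [Group P] [Finite P] (H : Subgroup P) (ℓ : β → Bool × P) :
    RealTimePDA β where
  Q := P
  Γ := Bool × P
  finite_Q := inferInstance
  finite_Γ := inferInstance
  q₀ := 1
  δ h b := push H h (ℓ b)
  acc h γ := by
    classical exact decide (h = 1 ∧ γ = none)

theorem pda_verdict {β P : Type} [Group P] [Finite P] (H : Subgroup P) (ℓ : β → Bool × P)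
    (w : List β) : (pda H ℓ).verdict w = true ↔ (w.map ℓ).foldl (move H) (1, []) = (1, []) := by
  have hrun : (pda H ℓ).run w = (w.map ℓ).foldl (move H) (1, []) := by
    rw [List.foldl_map]
    rfl
  rw [RealTimePDA.verdict, hrun]
  simp [pda, Prod.ext_iff]

end AmalgamStack

/-- The action on cosets of `S` has the normal core as kernel. Permutations of `Fin m` serve as
target because states and stack letters must live in `Type`, whatever the universe of `G`. -/
theorem Subgroup.FiniteIndex.exists_hom_perm {G : Type u} [Group G] (S : Subgroup G)
    (hS : S.FiniteIndex) : ∃ (m : ℕ) (θ : G →* Equiv.Perm (Fin m)), θ.ker ≤ S := by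
  obtain ⟨m, ⟨e⟩⟩ := Finite.exists_equiv_fin (G ⧸ S)
  refine ⟨m, e.permCongrHom.toMonoidHom.comp (MulAction.toPermHom G (G ⧸ S)), fun g hg => ?_⟩
  refine S.normalCore_le ?_
  rw [Subgroup.normalCore_eq_ker]
  simpa [MonoidHom.mem_ker] using hg

/-! ### The twisted double as an untwisted amalgam with a retraction. -/

namespace TwistedDouble

variable {G : Type u} {G' : Type v} [Group G] [Group G'] (S : Subgroup G) (φ : MulAut G)
  (bar : G ≃* G')

/-- The two embeddings of `G`, the second one adjusted by `φ` so that they agree on `S`. As `φ` is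
defined on all of `G`, this reduces the twisted double to an untwisted one, whatever the order of `φ`. -/
def incl : Bool → G →* TwistedDouble S φ bar
  | true => (QuotientGroup.mk' _).comp Monoid.Coprod.inl
  | false => (QuotientGroup.mk' _).comp
      (Monoid.Coprod.inr.comp (bar.toMonoidHom.comp φ.symm.toMonoidHom))

variable {S φ bar}

/-- As `φ` maps `S` onto itself, each element of `S` is some `φ s` with `s ∈ S`, and the claim
becomes the defining relation for `s`. -/
theorem incl_false_eq (hφS : S.map φ.toMonoidHom = S) (s : G) (hs : s ∈ S) :
    incl S φ bar false s = incl S φ bar true s := by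
  rw [← hφS] at hs
  obtain ⟨s, hs, rfl⟩ := hs
  refine ((QuotientGroup.eq_iff_div_mem).2 ?_).symm
  exact Subgroup.subset_normalClosure ⟨s, hs, by simp [div_eq_mul_inv]⟩

/-- The homomorphism given by two homomorphisms from `G` that agree on `S`. -/
def lift {E : Type*} [Group E] (hφS : S.map φ.toMonoidHom = S) (j : Bool → G →* E)
    (hj : ∀ s ∈ S, j false s = j true s) : TwistedDouble S φ bar →* E :=
  QuotientGroup.lift _
    -- The composite with `φ` on the second factor cancels the adjustment made in `incl`.
    (Monoid.Coprod.lift (j true) ((j false).comp (φ.toMonoidHom.comp bar.symm.toMonoidHom)))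
    (Subgroup.normalClosure_le_normal <| by
      rintro _ ⟨s, hs, rfl⟩
      have : φ s ∈ S := hφS ▸ ⟨s, hs, rfl⟩
      simp [MonoidHom.mem_ker, hj _ this])

theorem lift_incl {E : Type*} [Group E] (hφS : S.map φ.toMonoidHom = S) (j : Bool → G →* E)
    (hj : ∀ s ∈ S, j false s = j true s) (i : Bool) (g : G) :
    lift hφS j hj (incl S φ bar i g) = j i g := by
  cases i <;> simp [lift, incl]

theorem range_incl_sup :
    (incl S φ bar true).range ⊔ (incl S φ bar false).range = ⊤ := by
  rw [eq_top_iff]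
  rintro x -
  obtain ⟨x, rfl⟩ := QuotientGroup.mk_surjective x
  induction x using Monoid.Coprod.induction_on with
  | inl g => exact Subgroup.mem_sup_left ⟨g, rfl⟩
  | inr g => exact Subgroup.mem_sup_right ⟨φ (bar.symm g), by simp [incl]⟩
  | mul x y hx hy => exact mul_mem hx hy

/-- Generators of a double: both copies of the given generators. -/
def gens {n m : ℕ} (e : Bool × Fin n ≃ Fin m) (x : Fin n → G) (l : Fin m) :
    TwistedDouble S φ bar :=
  incl S φ bar (e.symm l).1 (x (e.symm l).2)

theorem closure_range_gens {n m : ℕ} (e : Bool × Fin n ≃ Fin m) {x : Fin n → G}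
    (hx : Subgroup.closure (Set.range x) = ⊤) :
    Subgroup.closure (Set.range (gens (S := S) (φ := φ) (bar := bar) e x)) = ⊤ := by
  rw [← top_le_iff, ← range_incl_sup]
  have (i : Bool) : (incl S φ bar i).range ≤
      Subgroup.closure (Set.range (gens (S := S) (φ := φ) (bar := bar) e x)) := by
    rw [MonoidHom.range_eq_map, ← hx, MonoidHom.map_closure]
    refine Subgroup.closure_mono ?_
    rintro _ ⟨_, ⟨l, rfl⟩, rfl⟩
    exact ⟨e (i, l), by simp [gens]⟩
  exact sup_le (this true) (this false)

/-- Forgetting the copy to which a letter belongs is the folding map on words, so the second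
condition says that the fold is trivial in `G`. -/
theorem exists_wordProblem_gens_eq (hS : S.FiniteIndex) (hφS : S.map φ.toMonoidHom = S)
    {n m : ℕ} (e : Bool × Fin n ≃ Fin m) (x : Fin n → G) :
    ∃ A : RealTimePDA (Fin m × Bool), wordProblem (gens (S := S) (φ := φ) (bar := bar) e x) =
      {w : List (Fin m × Bool) | A.verdict w = true ∧
        w.map (fun l => ((e.symm l.1).2, l.2)) ∈ wordProblem x} := by
  obtain ⟨k, θ, hθ⟩ := hS.exists_hom_perm
  let ℓ : Fin m × Bool → Bool × G := fun l =>
    ((e.symm l.1).1, if l.2 then x (e.symm l.1).2 else (x (e.symm l.1).2)⁻¹)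
  refine ⟨AmalgamStack.pda (S.map θ) fun l => Prod.map id θ (ℓ l), Set.ext fun w => ?_⟩
  -- The first `lift` maps to the amalgam and gives access to normal forms; the second is the
  -- folding retraction. `ker θ ≤ S` makes `S` the full preimage of `S.map θ`.
  have key := AmalgamStack.prod_eq_one_iff θ (Subgroup.comap_map_eq_self hθ)
    (incl S φ bar) (incl_false_eq hφS)
    (lift hφS (fun i => Monoid.PushoutI.of (φ := fun _ : Bool => S.subtype) i) fun s hs =>
      (Monoid.PushoutI.of_apply_eq_base (fun _ : Bool => S.subtype) false ⟨s, hs⟩).trans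
        (Monoid.PushoutI.of_apply_eq_base (fun _ : Bool => S.subtype) true ⟨s, hs⟩).symm)
    (lift_incl hφS _ _) (lift hφS (fun _ => MonoidHom.id G) fun _ _ => rfl) (lift_incl hφS _ _)
    (w.map ℓ)
  have hgens : (fun l : Fin m × Bool =>
      if l.2 then gens (S := S) (φ := φ) (bar := bar) e x l.1 else (gens e x l.1)⁻¹) =
      fun l => incl S φ bar (ℓ l).1 (ℓ l).2 := by
    funext l
    by_cases hl : l.2 <;> simp [ℓ, gens, hl]
  simp only [List.map_map, Function.comp_def] at key
  rw [Set.mem_ofPred_eq, AmalgamStack.pda_verdict]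
  change ((w.map _).prod = 1) ↔ _ ∧ ((List.map _ (w.map _)).prod = 1)
  rw [hgens, List.map_map]
  exact key

end TwistedDouble

theorem mainTheorem6 {G : Type u} {G' : Type v} [Group G] [Group G']
    (S : Subgroup G) (hS : S.FiniteIndex)
    (φ : MulAut G) (hφ : IsOfFinOrder φ) (hφS : S.map φ.toMonoidHom = S)
    (bar : G ≃* G') :
    (InBDG G → InBDG (TwistedDouble S φ bar)) ∧
    (InPG G → InPG (TwistedDouble S φ bar)) := by
  constructor
  · rintro ⟨n, x, hx, hL⟩
    obtain ⟨m, ⟨e⟩⟩ := Finite.exists_equiv_fin (Bool × Fin n)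
    obtain ⟨A, hA⟩ := TwistedDouble.exists_wordProblem_gens_eq (bar := bar) hS hφS e x
    exact ⟨m, _, TwistedDouble.closure_range_gens e hx, hA ▸ hL.inter_realTimePDA _ A⟩
  · rintro ⟨n, x, hx, hL⟩
    obtain ⟨m, ⟨e⟩⟩ := Finite.exists_equiv_fin (Bool × Fin n)
    obtain ⟨A, hA⟩ := TwistedDouble.exists_wordProblem_gens_eq (bar := bar) hS hφS e x
    exact ⟨m, _, TwistedDouble.closure_range_gens e hx, hA ▸ hL.inter_realTimePDA _ A⟩
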